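/- Let $d\ge 2$, let $r,\ell\ge 1$ be integers, $1\le p\le\infty$ and $\alpha\in[0,1)$. Let $\mathbb S^{d-1}$ be the unit sphere of $\mathbb R^d$ with surface measure $\sigma$, and let $\|\cdot\|_p$ be the norm of the space $L^p(\mathbb S^{d-1})$ of real functions, where for $p=\infty$ the space $L^\infty$ is replaced by $C(\mathbb S^{d-1})$ with the uniform norm. For $1\le i<j\le d$ let $Q_{i,j,\theta}$ be the rotation by the angle $\theta$ in the $(x_i,x_j)$-plane, oriented from $e_i$ to $e_j$; put $\Delta^m_{i,j,\theta}=(I-T_{i,j,\theta})^m$ with $T_{i,j,\theta}f(x)=f(Q_{i,j,\theta}x)$, and $$\omega_m(f,t)_p=\sup_{|\theta|\le t}\ \max_{1\le i<j\le d}\|\Delta^m_{i,j,\theta}f\|_p .$$ Let $D_{i,j}g(x)=\frac{\partial}{\partial t}g(Q_{i,j,t}^{-1}x)\big|_{t=0}$ for $g\in C^\infty(\mathbb S^{d-1})$; the distributional derivative $D_{i,j}^rf$ is defined by $\int (D_{i,j}^rf)\,g\,d\sigma=(-1)^r\int f\,D_{i,j}^rg\,d\sigma$ for all $g\in C^\infty(\mathbb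 S^{d-1})$. Let $\mathcal W_p^r$ be the space of all $f\in L^p(\mathbb S^{d-1})$ such that $D_{i,j}^rf\in L^p(\mathbb S^{d-1})$ for all $1\le i<j\le d$ (both with $C$ in place of $L^\infty$ if $p=\infty$). Let $\mathcal W_p^{r,\alpha}$ be the space of all $f\in\mathcal W_p^r$ with $$\|f\|_{\mathcal W_p^{r,\alpha}}=\|f\|_p+\max_{1\le i<j\le d}\ \sup_{0<|\theta|\le1}\frac{\|\Delta^\ell_{i,j,\theta}(D_{i,j}^rf)\|_p}{|\theta|^\alpha}<\infty,$$ and let $H_p^{r+\alpha}$ be the space of all $f\in L^p(\mathbb S^{d-1})$ ($f\in C(\mathbb S^{d-1})$ if $p=\infty$) with $$\|f\|_{H_p^{r+\alpha}}=\|f\|_p+\sup_{0<t\le1}\frac{\omega_{r+\ell}(f,t)_p}{t^{r+\alpha}}<\infty .$$ Then $\mathcal W_p^{r,\alpha}\subseteq H_p^{r+\alpha}$, and there is a constant $c>0$, depending only on $d,r,\ell,p,\alpha$, such that $\|f\|_{H_p^{r+\alpha}}\le c\,\|f\|_{\mathcal W_p^{r,\alpha}}$ for all $f\in\mathcal W_p^{r,\alpha}$.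 If moreover $\alpha>0$, then $$\mathcal W_p^{r,\alpha}=H_p^{r+\alpha}$$ and the norms are equivalent: also $\|f\|_{\mathcal W_p^{r,\alpha}}\le c\,\|f\|_{H_p^{r+\alpha}}$ for all $f$ in this space. -/

import Mathlib

open scoped ENNReal
open MeasureTheory

noncomputable section

namespace SphereLip

/-- The ambient Euclidean space `ℝ^d`. -/
abbrev E (d : ℕ) : Type := EuclideanSpace ℝ (Fin d)

/-- The unit sphere `S^{d-1}` of `ℝ^d`. -/
abbrev S (d : ℕ) : Type := Metric.sphere (0 : E d) 1

/-- The surface (Lebesgue) measure on `S^{d-1}`. -/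
def σ (d : ℕ) : Measure (S d) := (volume : Measure (E d)).toSphere

/-- The rotation `Q_{i,j,t}` of `ℝ^d` by the angle `t` in the `(x_i, x_j)`-plane, oriented from
`e_i` to `e_j` (a rotation when `i ≠ j`). -/
def rotVec {d : ℕ} (i j : Fin d) (t : ℝ) (x : E d) : E d :=
  WithLp.toLp 2 fun k =>
    if k = i then x i * Real.cos t - x j * Real.sin t
    else if k = j then x i * Real.sin t + x j * Real.cos t
    else x k

theorem norm_rotVec {d : ℕ} {i j : Fin d} (h : i ≠ j) (t : ℝ) (x : E d) :
    ‖rotVec i j t x‖ = ‖x‖ := by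
  have key : ∀ y : E d, ∑ k, y k ^ 2
      = y i ^ 2 + (y j ^ 2 + ∑ k ∈ (Finset.univ.erase i).erase j, y k ^ 2) := by
    intro y
    rw [Finset.add_sum_erase (Finset.univ.erase i) (fun k => y k ^ 2)
      (Finset.mem_erase.2 ⟨h.symm, Finset.mem_univ j⟩),
      Finset.add_sum_erase Finset.univ (fun k => y k ^ 2) (Finset.mem_univ i)]
  have hsq : ‖rotVec i j t x‖ ^ 2 = ‖x‖ ^ 2 := by
    rw [EuclideanSpace.real_norm_sq_eq, EuclideanSpace.real_norm_sq_eq, key, key]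
    have h3 : ∑ k ∈ (Finset.univ.erase i).erase j, rotVec i j t x k ^ 2
        = ∑ k ∈ (Finset.univ.erase i).erase j, x k ^ 2 := by
      refine Finset.sum_congr rfl fun k hk => ?_
      have hj : k ≠ j := (Finset.mem_erase.1 hk).1
      have hi : k ≠ i := (Finset.mem_erase.1 (Finset.mem_erase.1 hk).2).1
      simp [rotVec, hi, hj]
    have h1 : rotVec i j t x i = x i * Real.cos t - x j * Real.sin t := by simp [rotVec]
    have h2 : rotVec i j t x j = x i * Real.sin t + x j * Real.cos t := by
      simp [rotVec, h.symm]
    rw [h3, h1, h2]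
    linear_combination (x i ^ 2 + x j ^ 2) * Real.sin_sq_add_cos_sq t
  exact (sq_eq_sq₀ (norm_nonneg _) (norm_nonneg _)).1 hsq

/-- The rotation `Q_{i,j,t}` acting on the sphere. -/
def rot {d : ℕ} {i j : Fin d} (h : i ≠ j) (t : ℝ) (x : S d) : S d :=
  ⟨rotVec i j t x, by
    have hx : ‖(x : E d)‖ = 1 := mem_sphere_zero_iff_norm.1 x.2
    rw [mem_sphere_zero_iff_norm, norm_rotVec h, hx]⟩

/-- The difference operator `Δ_{i,j,θ} = I - T_{Q_{i,j,θ}}`, where `T_Q f (x) = f (Q x)`. -/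
def diff {d : ℕ} {i j : Fin d} (h : i ≠ j) (θ : ℝ) (f : S d → ℝ) : S d → ℝ :=
  fun x => f x - f (rot h θ x)

/-- The difference operator of order `m`, `Δ^m_{i,j,θ} = (I - T_{Q_{i,j,θ}})^m`. -/
def diffPow {d : ℕ} {i j : Fin d} (h : i ≠ j) (θ : ℝ) (m : ℕ) (f : S d → ℝ) : S d → ℝ :=
  (diff h θ)^[m] f

/-- The differential operator `D_{i,j}`, the infinitesimal operator
`D_{i,j} g (x) = ∂/∂t g (Q_{i,j,t}⁻¹ x)` at `t = 0`, for smooth `g`. -/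
def D {d : ℕ} {i j : Fin d} (h : i ≠ j) (g : S d → ℝ) : S d → ℝ :=
  fun x => deriv (fun t : ℝ => g (rot h (-t) x)) 0

/-- `C^∞(S^{d-1})`: since the sphere is a closed submanifold of `ℝ^d`, its smooth functions are
the restrictions of the smooth functions on `ℝ^d`. -/
def IsSmooth {d : ℕ} (g : S d → ℝ) : Prop :=
  ∃ G : E d → ℝ, ContDiff ℝ (⊤ : ℕ∞) G ∧ ∀ x : S d, g x = G x

/-- `f ∈ L^p(S^{d-1})`, where `L^∞` is replaced by `C(S^{d-1})`. -/
def MemX {d : ℕ} (p : ℝ≥0∞) (f : S d → ℝ) : Prop :=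
  if p = ∞ then Continuous f else MemLp f p (σ d)

/-- The norm `‖f‖_p`: the `L^p` norm for `p < ∞` and the uniform norm for `p = ∞`. -/
def normX {d : ℕ} (p : ℝ≥0∞) (f : S d → ℝ) : ℝ≥0∞ :=
  if p = ∞ then ⨆ x : S d, ‖f x‖ₑ else eLpNorm f p (σ d)

/-- `u` is the distributional derivative `D_{i,j}^r f`. -/
def IsWeakD {d : ℕ} {i j : Fin d} (h : i ≠ j) (r : ℕ) (f u : S d → ℝ) : Prop :=
  ∀ g : S d → ℝ, IsSmooth g →
    ∫ x, u x * g x ∂(σ d) = (-1) ^ r * ∫ x, f x * ((D h)^[r] g) x ∂(σ d)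

/-- The distributional derivative `D_{i,j}^r f` exists as an element of `L^p(S^{d-1})`
(of `C(S^{d-1})` if `p = ∞`). -/
def HasWeakD {d : ℕ} {i j : Fin d} (h : i ≠ j) (p : ℝ≥0∞) (r : ℕ) (f : S d → ℝ) : Prop :=
  ∃ u : S d → ℝ, MemX p u ∧ IsWeakD h r f u

open Classical in
/-- The distributional derivative `D_{i,j}^r f` (zero if it does not exist in the space). It is
unique up to a null set, and unique as a continuous function if `p = ∞`. -/
def weakD {d : ℕ} {i j : Fin d} (h : i ≠ j) (p : ℝ≥0∞) (r : ℕ) (f : S d → ℝ) : S d → ℝ :=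
  if H : HasWeakD h p r f then H.choose else 0

/-- The Sobolev space `𝒲_p^r(S^{d-1})`. -/
def sobolev (d : ℕ) (p : ℝ≥0∞) (r : ℕ) : Set (S d → ℝ) :=
  {f | MemX p f ∧ ∀ (i j : Fin d) (h : i < j), HasWeakD h.ne p r f}

/-- The modulus of smoothness `ω_m(f,t)_p`. -/
def modulus {d : ℕ} (p : ℝ≥0∞) (m : ℕ) (f : S d → ℝ) (t : ℝ) : ℝ≥0∞ :=
  ⨆ (θ : ℝ) (_ : |θ| ≤ t) (i : Fin d) (j : Fin d) (h : i < j), normX p (diffPow h.ne θ m f)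

/-- The norm of `𝒲_p^{r,α}(S^{d-1})`, with differences of order `l`, for `f ∈ 𝒲_p^r`. -/
def lipNorm {d : ℕ} (p : ℝ≥0∞) (r l : ℕ) (α : ℝ) (f : S d → ℝ) : ℝ≥0∞ :=
  normX p f + ⨆ (i : Fin d) (j : Fin d) (h : i < j) (θ : ℝ) (_ : 0 < |θ| ∧ |θ| ≤ 1),
    normX p (diffPow h.ne θ l (weakD h.ne p r f)) / ENNReal.ofReal (|θ| ^ α)

/-- The Lipschitz space `𝒲_p^{r,α}(S^{d-1})`. -/
def lipSpace (d : ℕ) (p : ℝ≥0∞) (r l : ℕ) (α : ℝ) : Set (S d → ℝ) :=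
  {f | f ∈ sobolev d p r ∧ lipNorm p r l α f < ∞}

/-- The norm of `H_p^{r+α}`. -/
def hNorm {d : ℕ} (p : ℝ≥0∞) (r l : ℕ) (α : ℝ) (f : S d → ℝ) : ℝ≥0∞ :=
  normX p f + ⨆ (t : ℝ) (_ : 0 < t ∧ t ≤ 1),
    modulus p (r + l) f t / ENNReal.ofReal (t ^ ((r : ℝ) + α))

/-- The space `H_p^{r+α}`. -/
def hSpace (d : ℕ) (p : ℝ≥0∞) (r l : ℕ) (α : ℝ) : Set (S d → ℝ) :=
  {f | MemX p f ∧ hNorm p r l α f < ∞}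

end SphereLip

end

/-! For a fixed coordinate plane the rotations act on X, which is `L^p` or `C`, as a strongly
continuous group `T` of contractions. By invariance of the measure, the `r`-th weak derivative `u`
of `f` is `(-1)^r` times the `r`-th power of the generator applied to `f`. The argument is carried
out for abstract groups whose generator is known only through pairings with test objects, one plane
at a time.

Direct part: with `J_θ x = ∫_0^θ T_s x ds`, the fundamental theorem of calculus gives `(I - T_θ)^r f
= J_θ^r u` (`diff_pow_eq`). Since `‖J_θ‖ ≤ |θ|`, differences of order `r + l` of `f` are at most
`|θ|^r` times differences of order `l` of `u`, for every `α ≥ 0`.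

Inverse part (`exists_weakDeriv_of_diff_pow_le`): as `r + α < r + 1`, Marchaud's inequality lowers
the order of the differences from `r + l` to `r + 1` at the same rate. The identity `I - T_{2θ} = (I
+ T_θ)(I - T_θ)` then shows that halving `θ` changes `θ^{-r} (I - T_θ)^r f` by `O(|θ|^α)`. For `α >
0` these changes are summable, so the quotients converge in X to a weak derivative `u`, at distance
`O(|θ|^α)`. Applying `(I - T_θ)^l` to the quotient and to the error bounds the differences of `u`.
-/

noncomputable section

namespace SphereLip

open Filter Topology

/-! ### Strongly continuous groups of isometries with test functionals -/

/-- A strongly continuous one-parameter group `T` of contractions of `X`, with a separating family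
`L` of functionals indexed by test objects on which the generator acts by `D`. -/
structure IsTestedGroup {X G : Type*} [NormedAddCommGroup X] [NormedSpace ℝ X]
    (T : ℝ → X →L[ℝ] X) (L : G → X →L[ℝ] ℝ) (D : G → G) : Prop where
  zero : T 0 = 1
  add : ∀ s t, T (s + t) = T s * T t
  norm_le : ∀ t x, ‖T t x‖ ≤ ‖x‖
  cont : ∀ x, Continuous fun t => T t x
  hasDerivAt : ∀ g x, HasDerivAt (fun t => L g (T t x)) (L (D g) x) 0
  translate : ∀ t g, ∃ g', ∀ k x, L (D^[k] g) (T t x) = L (D^[k] g') x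
  separating : ∀ x, (∀ g, L g x = 0) → x = 0

/-- `u` is the `r`-th weak derivative of `f` with respect to the test functionals `L`. -/
def IsWeakDeriv {X G : Type*} [NormedAddCommGroup X] [NormedSpace ℝ X]
    (L : G → X →L[ℝ] ℝ) (D : G → G) (r : ℕ) (f u : X) : Prop :=
  ∀ g, L g u = (-1) ^ r * L (D^[r] g) f

namespace IsTestedGroup

variable {X G : Type*} [NormedAddCommGroup X] [NormedSpace ℝ X]
  {T : ℝ → X →L[ℝ] X} {L : G → X →L[ℝ] ℝ} {D : G → G}

/-- The integral of the orbit of `x` over `[0, θ]`. -/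
def orbitIntegral (T : ℝ → X →L[ℝ] X) (θ : ℝ) (x : X) : X := ∫ s in (0 : ℝ)..θ, T s x

theorem commute (hT : IsTestedGroup T L D) (s t : ℝ) : Commute (T s) (T t) := by
  rw [Commute, SemiconjBy, ← hT.add, ← hT.add, add_comm]

theorem hasDerivAt_orbit (hT : IsTestedGroup T L D) (g : G) (x : X) (t : ℝ) :
    HasDerivAt (fun s => L g (T s x)) (L (D g) (T t x)) t := by
  have h := hT.hasDerivAt g (T t x)
  have h2 : HasDerivAt (fun s : ℝ => s - t) 1 t := (hasDerivAt_id t).sub_const t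
  have h3 := HasDerivAt.comp_of_eq t h h2 (sub_self t).symm
  rw [mul_one] at h3
  refine h3.congr_of_eventuallyEq (Eventually.of_forall fun s => ?_)
  change L g (T s x) = L g ((T (s - t) * T t) x)
  rw [← hT.add, sub_add_cancel]

theorem weakDeriv_unique (hT : IsTestedGroup T L D) {r : ℕ} {f u v : X}
    (hu : IsWeakDeriv L D r f u) (hv : IsWeakDeriv L D r f v) : u = v :=
  sub_eq_zero.1 <| hT.separating _ fun g => by rw [map_sub, hu, hv, sub_self]

/-- The adjoint of `T t` acts on test objects and commutes with `D`, which is why `translate`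
supplies one `g'` for all powers `k`. -/
theorem weakDeriv_translate (hT : IsTestedGroup T L D) {r : ℕ} {f u : X}
    (hu : IsWeakDeriv L D r f u) (t : ℝ) : IsWeakDeriv L D r (T t f) (T t u) := by
  intro g
  obtain ⟨g', hg'⟩ := hT.translate t g
  rw [hg' r f, show L g (T t u) = L g' u from hg' 0 u]
  exact hu g'

theorem norm_diff_le (hT : IsTestedGroup T L D) (θ : ℝ) (x : X) : ‖(1 - T θ) x‖ ≤ 2 * ‖x‖ := by
  calc ‖(1 - T θ) x‖ = ‖x - T θ x‖ := rfl
    _ ≤ ‖x‖ + ‖T θ x‖ := norm_sub_le _ _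
    _ ≤ 2 * ‖x‖ := by linarith [hT.norm_le θ x]

theorem norm_diff_pow_le (hT : IsTestedGroup T L D) (θ : ℝ) (k : ℕ) (x : X) :
    ‖((1 - T θ) ^ k) x‖ ≤ 2 ^ k * ‖x‖ := by
  induction k with
  | zero => simp
  | succ k ih =>
    rw [pow_succ', pow_succ']
    have := hT.norm_diff_le θ (((1 - T θ) ^ k) x)
    change ‖(1 - T θ) (((1 - T θ) ^ k) x)‖ ≤ _
    linarith

theorem weakDeriv_diff_pow (hT : IsTestedGroup T L D) {r : ℕ} {f u : X}
    (hu : IsWeakDeriv L D r f u) (θ : ℝ) (k : ℕ) :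
    IsWeakDeriv L D r (((1 - T θ) ^ k) f) (((1 - T θ) ^ k) u) := by
  induction k with
  | zero => simpa using hu
  | succ k ih =>
    intro g
    rw [pow_succ']
    change L g (((1 - T θ) ^ k) u - T θ (((1 - T θ) ^ k) u))
      = (-1) ^ r * L (D^[r] g) (((1 - T θ) ^ k) f - T θ (((1 - T θ) ^ k) f))
    rw [map_sub, map_sub, ih g, hT.weakDeriv_translate ih θ g]
    ring

theorem intervalIntegrable (hT : IsTestedGroup T L D) (x : X) (a b : ℝ) :
    IntervalIntegrable (fun s => T s x) volume a b :=
  (hT.cont x).intervalIntegrable a b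

theorem clm_orbitIntegral [CompleteSpace X] (hT : IsTestedGroup T L D) {Y : Type*} [NormedAddCommGroup Y]
    [NormedSpace ℝ Y] [CompleteSpace Y] (A : X →L[ℝ] Y) (θ : ℝ) (x : X) :
    A (orbitIntegral T θ x) = ∫ s in (0 : ℝ)..θ, A (T s x) :=
  (A.intervalIntegral_comp_comm (hT.intervalIntegrable x 0 θ)).symm

theorem norm_orbitIntegral_le (hT : IsTestedGroup T L D) (θ : ℝ) (x : X) :
    ‖orbitIntegral T θ x‖ ≤ |θ| * ‖x‖ := by
  have := intervalIntegral.norm_integral_le_of_norm_le_const (a := (0 : ℝ)) (b := θ)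
    (fun s _ => hT.norm_le s x)
  rw [sub_zero, mul_comm] at this
  exact this

theorem norm_orbitIntegral_iterate_le (hT : IsTestedGroup T L D) (θ : ℝ) (k : ℕ) (x : X) :
    ‖(orbitIntegral T θ)^[k] x‖ ≤ |θ| ^ k * ‖x‖ := by
  induction k with
  | zero => simp
  | succ k ih =>
    rw [Function.iterate_succ_apply', pow_succ', mul_assoc]
    exact (hT.norm_orbitIntegral_le θ _).trans (by gcongr)

theorem weakDeriv_orbitIntegral [CompleteSpace X] (hT : IsTestedGroup T L D) {r : ℕ} {f u : X}
    (hu : IsWeakDeriv L D r f u) (θ : ℝ) :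
    IsWeakDeriv L D r (orbitIntegral T θ f) (orbitIntegral T θ u) := by
  intro g
  rw [hT.clm_orbitIntegral, hT.clm_orbitIntegral, ← intervalIntegral.integral_const_mul]
  exact intervalIntegral.integral_congr fun s _ => hT.weakDeriv_translate hu s g

theorem weakDeriv_orbitIntegral_iterate [CompleteSpace X] (hT : IsTestedGroup T L D) {r : ℕ} {f u : X}
    (hu : IsWeakDeriv L D r f u) (θ : ℝ) (k : ℕ) :
    IsWeakDeriv L D r ((orbitIntegral T θ)^[k] f) ((orbitIntegral T θ)^[k] u) := by
  induction k with
  | zero => exact hu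
  | succ k ih =>
    rw [Function.iterate_succ_apply', Function.iterate_succ_apply']
    exact hT.weakDeriv_orbitIntegral ih θ

/-- Fundamental theorem of calculus along the orbit, tested against `g`; no regularity of `x` is
needed, because the orbit integral already lies in the domain of the generator. -/
theorem diff_eq_weakDeriv_orbitIntegral [CompleteSpace X] (hT : IsTestedGroup T L D) (θ : ℝ) (g : G) (x : X) :
    L g ((1 - T θ) x) = -L (D g) (orbitIntegral T θ x) := by
  have h := intervalIntegral.integral_eq_sub_of_hasDerivAt (a := (0 : ℝ)) (b := θ)
    (fun t _ => hT.hasDerivAt_orbit g x t)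
    (((L (D g)).continuous.comp (hT.cont x)).intervalIntegrable _ _)
  rw [hT.clm_orbitIntegral, h, hT.zero]
  change L g (x - T θ x) = _
  rw [map_sub]
  simp

theorem orbitIntegral_diff [CompleteSpace X] (hT : IsTestedGroup T L D) (θ : ℝ) (x : X) :
    orbitIntegral T θ ((1 - T θ) x) = (1 - T θ) (orbitIntegral T θ x) := by
  rw [hT.clm_orbitIntegral]
  refine intervalIntegral.integral_congr fun s _ => ?_
  exact DFunLike.congr_fun ((Commute.one_right (T s)).sub_right (hT.commute s θ)).eq x

theorem diff_pow_isWeakDeriv [CompleteSpace X] (hT : IsTestedGroup T L D) (θ : ℝ) (k : ℕ) (x : X) :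
    IsWeakDeriv L D k ((orbitIntegral T θ)^[k] x) (((1 - T θ) ^ k) x) := by
  induction k generalizing x with
  | zero => intro g; simp
  | succ k ih =>
    intro g
    rw [pow_succ, Function.iterate_succ_apply']
    change L g (((1 - T θ) ^ k) ((1 - T θ) x)) = _
    have hcomm : (orbitIntegral T θ)^[k] ((1 - T θ) x) = (1 - T θ) ((orbitIntegral T θ)^[k] x) :=
      Function.Commute.iterate_left (fun y => hT.orbitIntegral_diff θ y) k x
    rw [ih, hcomm, hT.diff_eq_weakDeriv_orbitIntegral, Function.iterate_succ_apply', pow_succ]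
    ring

/-- If `u` is the `r`-th weak derivative of `f`, the `r`-th difference of `f` is the iterated
orbit integral of `u`. -/
theorem diff_pow_eq [CompleteSpace X] (hT : IsTestedGroup T L D) {r : ℕ} {f u : X}
    (hu : IsWeakDeriv L D r f u) (θ : ℝ) :
    ((1 - T θ) ^ r) f = (orbitIntegral T θ)^[r] u :=
  -- Both sides are `r`-th weak derivatives of the iterated orbit integral of `f`.
  hT.weakDeriv_unique (hT.diff_pow_isWeakDeriv θ r f) (hT.weakDeriv_orbitIntegral_iterate hu θ r)

theorem norm_diff_pow_add_le [CompleteSpace X] (hT : IsTestedGroup T L D) {r : ℕ} {f u : X}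
    (hu : IsWeakDeriv L D r f u) (θ : ℝ) (l : ℕ) :
    ‖((1 - T θ) ^ (r + l)) f‖ ≤ |θ| ^ r * ‖((1 - T θ) ^ l) u‖ := by
  rw [pow_add]
  change ‖((1 - T θ) ^ r) (((1 - T θ) ^ l) f)‖ ≤ _
  rw [hT.diff_pow_eq (hT.weakDeriv_diff_pow hu θ l)]
  exact hT.norm_orbitIntegral_iterate_le θ r _

/-! ### The inverse estimate -/

theorem tendsto_orbitIntegral [CompleteSpace X] (hT : IsTestedGroup T L D) (x : X) :
    Tendsto (fun θ : ℝ => θ⁻¹ • orbitIntegral T θ x) (𝓝[≠] 0) (𝓝 x) := by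
  have h := intervalIntegral.integral_hasDerivAt_right (hT.intervalIntegrable x 0 0)
    ((hT.cont x).stronglyMeasurableAtFilter _ _) (hT.cont x).continuousAt
  have h2 := h.tendsto_slope_zero
  simpa [orbitIntegral, hT.zero] using h2

theorem orbitIntegral_sub (hT : IsTestedGroup T L D) (θ : ℝ) (x y : X) :
    orbitIntegral T θ (x - y) = orbitIntegral T θ x - orbitIntegral T θ y := by
  simp only [orbitIntegral, map_sub]
  exact intervalIntegral.integral_sub (hT.intervalIntegrable x 0 θ) (hT.intervalIntegrable y 0 θ)

theorem orbitIntegral_smul (θ c : ℝ) (x : X) :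
    orbitIntegral T θ (c • x) = c • orbitIntegral T θ x := by
  simp only [orbitIntegral, map_smul]
  exact intervalIntegral.integral_smul _ _

/-- The averages `θ⁻¹ J_θ` are contractions converging strongly to the identity, so their powers
converge too. -/
theorem tendsto_orbitIntegral_iterate [CompleteSpace X] (hT : IsTestedGroup T L D) (k : ℕ) (x : X) :
    Tendsto (fun θ : ℝ => (θ ^ k)⁻¹ • (orbitIntegral T θ)^[k] x) (𝓝[≠] 0) (𝓝 x) := by
  induction k with
  | zero => simp
  | succ k ih =>
    have h1 : Tendsto (fun θ : ℝ => θ⁻¹ • orbitIntegral T θ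
        ((θ ^ k)⁻¹ • (orbitIntegral T θ)^[k] x - x)) (𝓝[≠] 0) (𝓝 0) := by
      refine squeeze_zero_norm' ?_ (tendsto_iff_norm_sub_tendsto_zero.1 ih)
      filter_upwards [self_mem_nhdsWithin] with θ hθ
      rw [norm_smul, norm_inv, Real.norm_eq_abs, inv_mul_le_iff₀ (abs_pos.2 hθ)]
      exact hT.norm_orbitIntegral_le θ _
    have h2 := h1.add (hT.tendsto_orbitIntegral x)
    rw [zero_add] at h2
    refine h2.congr fun θ => ?_
    rw [hT.orbitIntegral_sub, orbitIntegral_smul, smul_sub, sub_add_cancel, smul_smul,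
      Function.iterate_succ_apply', pow_succ', mul_inv]

/-- A strong limit of difference quotients is a weak derivative. -/
theorem isWeakDeriv_of_tendsto [CompleteSpace X] (hT : IsTestedGroup T L D) {r : ℕ} {f u : X} {θ : ℕ → ℝ}
    (hθ : Tendsto θ atTop (𝓝[≠] 0))
    (h : Tendsto (fun n => (θ n ^ r)⁻¹ • ((1 - T (θ n)) ^ r) f) atTop (𝓝 u)) :
    IsWeakDeriv L D r f u := by
  intro g
  refine tendsto_nhds_unique (((L g).continuous.tendsto u).comp h) ?_
  -- Each difference is a weak derivative of an iterated orbit integral, so `D^r` moves to the test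
  -- object and the remaining averages tend to `f`.
  have h2 := (((L (D^[r] g)).continuous.tendsto f).comp
    ((hT.tendsto_orbitIntegral_iterate r f).comp hθ)).const_mul ((-1) ^ r)
  refine h2.congr fun n => ?_
  simp only [Function.comp_apply, map_smul, smul_eq_mul, hT.diff_pow_isWeakDeriv (θ n) r f g]
  ring

/-- `2^k - (1 + T)^k` is divisible by `1 - T`, and each power of `1 + T` costs at most a factor 2;
the constant is not sharp. -/
theorem norm_two_pow_sub_le (hT : IsTestedGroup T L D) (θ : ℝ) (k : ℕ) (x : X) :
    ‖(2 : ℝ) ^ k • x - ((1 + T θ) ^ k) x‖ ≤ k * 2 ^ k * ‖(1 - T θ) x‖ := by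
  have hpow : ∀ (k : ℕ) (y : X), ‖((1 + T θ) ^ k) y‖ ≤ 2 ^ k * ‖y‖ := by
    intro k y
    induction k with
    | zero => simp
    | succ k ih =>
      rw [pow_succ', pow_succ']
      calc ‖((1 + T θ) ^ k) y + T θ (((1 + T θ) ^ k) y)‖
          ≤ ‖((1 + T θ) ^ k) y‖ + ‖T θ (((1 + T θ) ^ k) y)‖ := norm_add_le _ _
        _ ≤ 2 * 2 ^ k * ‖y‖ := by linarith [hT.norm_le θ (((1 + T θ) ^ k) y)]
  induction k with
  | zero => simp
  | succ k ih =>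
    have e : (2 : ℝ) ^ (k + 1) • x - ((1 + T θ) ^ (k + 1)) x
        = (2 : ℝ) • ((2 : ℝ) ^ k • x - ((1 + T θ) ^ k) x) + ((1 + T θ) ^ k) ((1 - T θ) x) := by
      rw [pow_succ (1 + T θ)]
      change (2 : ℝ) ^ (k + 1) • x - ((1 + T θ) ^ k) (x + T θ x)
        = (2 : ℝ) • ((2 : ℝ) ^ k • x - ((1 + T θ) ^ k) x) + ((1 + T θ) ^ k) (x - T θ x)
      rw [map_add, map_sub]
      module
    rw [e]
    refine (norm_add_le _ _).trans ?_
    rw [norm_smul, Real.norm_ofNat]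
    have := hpow k ((1 - T θ) x)
    have h0 : 0 ≤ 2 ^ k * ‖(1 - T θ) x‖ := by positivity
    rw [Nat.cast_succ, pow_succ]
    linarith

/-- From `I - T_{2θ} = (I + T_θ)(I - T_θ)` with commuting factors. -/
theorem norm_diff_two_mul_le (hT : IsTestedGroup T L D) (θ : ℝ) (k : ℕ) (x : X) :
    ‖(2 : ℝ) ^ k • ((1 - T θ) ^ k) x - ((1 - T (2 * θ)) ^ k) x‖
      ≤ k * 2 ^ k * ‖((1 - T θ) ^ (k + 1)) x‖ := by
  have e : (1 - T (2 * θ)) ^ k = (1 + T θ) ^ k * (1 - T θ) ^ k := by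
    have hc : Commute (1 + T θ) (1 - T θ) :=
      ((Commute.one_right _).sub_right ((Commute.one_left _).add_left (Commute.refl _)))
    rw [← hc.mul_pow, two_mul, hT.add]
    congr 1
    noncomm_ring
  rw [e, pow_succ']
  exact hT.norm_two_pow_sub_le θ k _

end IsTestedGroup

/-- Marchaud's inequality, one step, for a family of real quantities `N k θ` that behave like
norms of differences of order `k` and step `θ`. -/
theorem marchaud_step (a : ℝ) (k : ℕ) (hak : a < k) :
    ∃ C : ℝ, 0 ≤ C ∧ ∀ (N : ℕ → ℝ → ℝ) (M : ℝ), 0 ≤ M → (∀ θ, 1 ≤ |θ| → N k θ ≤ M * |θ| ^ a) →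
      (∀ θ, 2 ^ k * N k θ ≤ N k (2 * θ) + k * 2 ^ k * N (k + 1) θ) →
      (∀ θ, θ ≠ 0 → N (k + 1) θ ≤ M * |θ| ^ a) →
      ∀ θ, θ ≠ 0 → N k θ ≤ C * M * |θ| ^ a := by
  set q : ℝ := 2 ^ (a - k) with hq
  have hq1 : q < 1 := Real.rpow_lt_one_of_one_lt_of_neg one_lt_two (by linarith)
  have hq0 : 0 < q := by positivity
  have hqk : (2 : ℝ) ^ a = q * 2 ^ k := by
    rw [hq, ← Real.rpow_natCast, ← Real.rpow_add two_pos, sub_add_cancel]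
  -- Chosen so that `q * C + k ≤ C`: one doubling of `θ` then reproduces the bound with the same
  -- constant.
  refine ⟨1 + k / (1 - q), by have : 0 < 1 - q := by linarith
                              positivity, ?_⟩
  intro N M hM hbase hstep hnext
  set C : ℝ := 1 + k / (1 - q) with hC
  have h1q : 0 < 1 - q := by linarith
  have hC1 : 1 ≤ C := by
    have : 0 ≤ k / (1 - q) := by positivity
    linarith
  have hqC : q * C + k ≤ C := by
    have : k / (1 - q) * (1 - q) = k := div_mul_cancel₀ _ h1q.ne'
    nlinarith
  -- Induction on the number of doublings that bring `|θ|` to at least 1, where the trivial bound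
  -- applies.
  have key : ∀ n : ℕ, ∀ θ : ℝ, 1 ≤ 2 ^ n * |θ| → N k θ ≤ C * M * |θ| ^ a := by
    intro n
    induction n with
    | zero =>
      intro θ hθ
      rw [pow_zero, one_mul] at hθ
      refine (hbase θ hθ).trans ?_
      have : 0 ≤ |θ| ^ a := by positivity
      gcongr
      nlinarith
    | succ n ih =>
      intro θ hθ
      have hθ0 : θ ≠ 0 := by
        rintro rfl
        norm_num at hθ
      have h1 := ih (2 * θ) (by rw [abs_mul, abs_two, ← mul_assoc, ← pow_succ]; exact hθ)
      have h2 := hstep θ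
      have h3 := hnext θ hθ0
      rw [abs_mul, abs_two, Real.mul_rpow two_pos.le (abs_nonneg _), hqk] at h1
      have hpk : (0 : ℝ) < 2 ^ k := by positivity
      have hθa : 0 ≤ |θ| ^ a := by positivity
      have h4 : 2 ^ k * N k θ ≤ 2 ^ k * ((q * C + k) * M * |θ| ^ a) := by
        have : (k : ℝ) * 2 ^ k * N (k + 1) θ ≤ k * 2 ^ k * (M * |θ| ^ a) := by gcongr
        linarith
      refine (le_of_mul_le_mul_left h4 hpk).trans ?_
      gcongr
  intro θ hθ
  obtain ⟨n, hn⟩ := pow_unbounded_of_one_lt (|θ|⁻¹) (one_lt_two (α := ℝ))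
  refine key n θ ?_
  rw [← inv_mul_cancel₀ (abs_pos.2 hθ).ne']
  gcongr

/-- Descends one order at a time; `P` and `Q` enlarge `M` so that the trivial bound and the estimate
just obtained share one constant. -/
theorem marchaud (a : ℝ) (k : ℕ) (hak : a < k) (l : ℕ) :
    ∃ C : ℝ, 0 ≤ C ∧ ∀ (N : ℕ → ℝ → ℝ) (M : ℝ), 0 ≤ M →
      (∀ j θ, 1 ≤ |θ| → N j θ ≤ 2 ^ j * M * |θ| ^ a) →
      (∀ j θ, 2 ^ j * N j θ ≤ N j (2 * θ) + j * 2 ^ j * N (j + 1) θ) →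
      (∀ θ, θ ≠ 0 → N (k + l) θ ≤ M * |θ| ^ a) →
      ∀ θ, θ ≠ 0 → N k θ ≤ C * M * |θ| ^ a := by
  induction l with
  | zero => exact ⟨1, zero_le_one, fun N M _ _ _ h => by simpa using h⟩
  | succ l ih =>
    obtain ⟨C, hC, h⟩ := ih
    obtain ⟨C', hC', h'⟩ := marchaud_step a (k + l) (by push_cast; linarith [l.cast_nonneg (α := ℝ)])
    set P : ℝ := 1 + 2 ^ (k + l) with hP
    have hP1 : 1 ≤ P := by rw [hP]; linarith [show (0 : ℝ) < 2 ^ (k + l) by positivity]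
    set Q : ℝ := 1 + C' * P with hQ
    have hQ0 : 1 ≤ Q := by rw [hQ]; linarith [show 0 ≤ C' * P by positivity]
    refine ⟨C * Q, by positivity, fun N M hM hbase hstep hnext => ?_⟩
    have h1 := h' N (P * M) (by positivity) (fun θ hθ => (hbase (k + l) θ hθ).trans (by
      gcongr; rw [hP]; linarith)) (fun θ => by simpa using hstep (k + l) θ)
      (fun θ hθ => (hnext θ hθ).trans (by gcongr; nlinarith))
    have h2 := h N (Q * M) (by positivity) (fun j θ hθ => (hbase j θ hθ).trans (by
      gcongr; nlinarith)) hstep (fun θ hθ => (h1 θ hθ).trans (by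
        rw [← mul_assoc]
        gcongr
        rw [hQ]
        linarith))
    intro θ hθ
    simpa only [mul_assoc] using h2 θ hθ

/-- The inverse estimate: smoothness of the differences of order `r + l` yields the `r`-th weak
derivative and smoothness of its differences of order `l`. -/
theorem exists_weakDeriv_of_diff_pow_le (r l : ℕ) (hr : 1 ≤ r) (hl : 1 ≤ l) (α : ℝ) (hα0 : 0 < α)
    (hα1 : α < 1) : ∃ C : ℝ, 0 ≤ C ∧ ∀ {X G : Type} [NormedAddCommGroup X] [NormedSpace ℝ X]
      [CompleteSpace X] {T : ℝ → X →L[ℝ] X} {L : G → X →L[ℝ] ℝ} {D : G → G},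
      IsTestedGroup T L D → ∀ (f : X) (M : ℝ), ‖f‖ ≤ M →
      (∀ θ, 0 < |θ| → |θ| ≤ 1 → ‖((1 - T θ) ^ (r + l)) f‖ ≤ M * |θ| ^ ((r : ℝ) + α)) →
      ∃ u, IsWeakDeriv L D r f u ∧
        ∀ θ, θ ≠ 0 → ‖((1 - T θ) ^ l) u‖ ≤ C * M * |θ| ^ α := by
  -- The order `r + 1` exceeds the exponent because `α < 1`, and `r + 1 + (l - 1) = r + l` because
  -- `1 ≤ l`.
  obtain ⟨C, hC, hmar⟩ := marchaud (r + α) (r + 1) (by push_cast; linarith) (l - 1)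
  set q : ℝ := 2 ^ (-α) with hq
  have hq1 : q < 1 := Real.rpow_lt_one_of_one_lt_of_neg one_lt_two (by linarith)
  have h1q : 0 < 1 - q := by linarith
  set P : ℝ := 2 ^ (r + l) with hP
  have hP1 : 1 ≤ P := one_le_pow₀ one_le_two
  set K : ℝ := r * (C * P) with hK
  have hK0 : 0 ≤ K := by positivity
  refine ⟨2 ^ l * (K / (1 - q)) + P, by positivity, ?_⟩
  intro X G _ _ _ T L D hT f M hfM hdiff
  have hM : 0 ≤ M := (norm_nonneg f).trans hfM
  have hrpow : ∀ θ : ℝ, |θ| ^ ((r : ℝ) + α) = |θ| ^ r * |θ| ^ α := by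
    intro θ
    rw [Real.rpow_add_of_nonneg (abs_nonneg _) (by positivity) hα0.le, Real.rpow_natCast]
  have hbig : ∀ θ : ℝ, 1 ≤ |θ| → 1 ≤ |θ| ^ ((r : ℝ) + α) := fun θ hθ =>
    Real.one_le_rpow hθ (by positivity)
  have hall : ∀ θ, θ ≠ 0 → ‖((1 - T θ) ^ (r + l)) f‖ ≤ P * M * |θ| ^ ((r : ℝ) + α) := by
    intro θ hθ
    rcases le_total |θ| 1 with h | h
    · refine (hdiff θ (abs_pos.2 hθ) h).trans ?_
      gcongr
      nlinarith
    · refine (hT.norm_diff_pow_le θ _ f).trans ?_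
      have := hbig θ h
      calc P * ‖f‖ ≤ P * M * 1 := by rw [mul_one]; gcongr
        _ ≤ _ := by gcongr
  have hnext : ∀ θ, θ ≠ 0 → ‖((1 - T θ) ^ (r + 1)) f‖ ≤ C * (P * M) * |θ| ^ ((r : ℝ) + α) := by
    refine hmar (fun k θ => ‖((1 - T θ) ^ k) f‖) (P * M) (by positivity) ?_ ?_ ?_
    · intro j θ hθ
      refine (hT.norm_diff_pow_le θ _ f).trans ?_
      have := hbig θ hθ
      calc (2 : ℝ) ^ j * ‖f‖ ≤ 2 ^ j * (P * M) * 1 := by rw [mul_one]; gcongr; nlinarith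
        _ ≤ _ := by gcongr
    · intro j θ
      have h1 := hT.norm_diff_two_mul_le θ j f
      have h2 := norm_sub_norm_le ((2 : ℝ) ^ j • ((1 - T θ) ^ j) f) (((1 - T (2 * θ)) ^ j) f)
      rw [norm_smul, norm_pow, Real.norm_ofNat] at h2
      linarith
    · intro θ hθ
      have : r + 1 + (l - 1) = r + l := by omega
      rw [this]
      exact hall θ hθ
  have hlim : ∀ θ, θ ≠ 0 → ∃ u, IsWeakDeriv L D r f u ∧
      ‖(θ ^ r)⁻¹ • ((1 - T θ) ^ r) f - u‖ ≤ K * M * |θ| ^ α / (1 - q) := by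
    intro θ hθ
    set s : ℕ → ℝ := fun n => θ / 2 ^ n with hs
    have hs0 : ∀ n, s n ≠ 0 := fun n => by positivity
    have hs2 : ∀ n, 2 * s (n + 1) = s n := fun n => by simp only [hs, pow_succ]; field_simp
    have habs : ∀ n, |s n| ^ α = |θ| ^ α * q ^ n := by
      intro n
      rw [hs, hq]
      simp only [abs_div, abs_pow, abs_two]
      rw [Real.div_rpow (abs_nonneg _) (by positivity), Real.rpow_neg two_pos.le, inv_pow,
        ← Real.rpow_natCast, ← Real.rpow_natCast, ← Real.rpow_mul two_pos.le,
        ← Real.rpow_mul two_pos.le, mul_comm α, div_eq_mul_inv]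
    set x : ℕ → X := fun n => (s n ^ r)⁻¹ • ((1 - T (s n)) ^ r) f with hx
    have hdist : ∀ n, dist (x n) (x (n + 1)) ≤ K * M * |θ| ^ α * q ^ n := by
      intro n
      set t := s (n + 1) with ht
      have ht0 : t ≠ 0 := hs0 _
      -- Consecutive steps are `t` and `2 * t`, so the increment is exactly what the doubling
      -- estimate controls.
      have e : x (n + 1) - x n = ((2 * t) ^ r)⁻¹ •
          ((2 : ℝ) ^ r • ((1 - T t) ^ r) f - ((1 - T (2 * t)) ^ r) f) := by
        simp only [hx, ← hs2 n, smul_sub, smul_smul]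
        congr 2
        rw [← ht, mul_pow, mul_inv, mul_right_comm, inv_mul_cancel₀ (by positivity), one_mul]
      rw [dist_comm, dist_eq_norm, e, norm_smul, norm_inv, norm_pow, Real.norm_eq_abs,
        inv_mul_le_iff₀ (by positivity)]
      refine (hT.norm_diff_two_mul_le t r f).trans ?_
      have h1 := hnext t ht0
      rw [hrpow] at h1
      have h2 : |t| ^ α ≤ |s n| ^ α := by
        rw [← hs2 n, abs_mul, abs_two]
        gcongr
        linarith [abs_nonneg t]
      rw [habs n] at h2
      calc (r : ℝ) * 2 ^ r * ‖((1 - T t) ^ (r + 1)) f‖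
          ≤ r * 2 ^ r * (C * (P * M) * (|t| ^ r * |t| ^ α)) := by gcongr
        _ ≤ r * 2 ^ r * (C * (P * M) * (|t| ^ r * (|θ| ^ α * q ^ n))) := by gcongr
        _ = _ := by rw [abs_mul, abs_two, mul_pow, hK]; ring
    obtain ⟨u, hu⟩ := cauchySeq_tendsto_of_complete
      (cauchySeq_of_le_geometric q _ hq1 hdist)
    refine ⟨u, hT.isWeakDeriv_of_tendsto (θ := s) ?_ hu, ?_⟩
    · refine tendsto_nhdsWithin_iff.2 ⟨?_, Eventually.of_forall hs0⟩
      exact tendsto_const_nhds.div_atTop (tendsto_pow_atTop_atTop_of_one_lt one_lt_two)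
    · have := dist_le_of_le_geometric_of_tendsto₀ q _ hq1 hdist hu
      rw [dist_eq_norm] at this
      simpa [hx, hs] using this
  -- The limit could depend on the starting step; uniqueness of weak derivatives identifies all
  -- these limits, so the error bound holds for one `u` at every `θ`.
  obtain ⟨u, hu, -⟩ := hlim 1 one_ne_zero
  refine ⟨u, hu, fun θ hθ => ?_⟩
  obtain ⟨v, hv, hbound⟩ := hlim θ hθ
  obtain rfl := hT.weakDeriv_unique hu hv
  have hθr : 0 < |θ| ^ r := by positivity
  set y := (θ ^ r)⁻¹ • ((1 - T θ) ^ r) f with hy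
  have h1 : ‖((1 - T θ) ^ l) y‖ ≤ P * M * |θ| ^ α := by
    rw [hy, map_smul, norm_smul, norm_inv, norm_pow, Real.norm_eq_abs, inv_mul_le_iff₀ hθr]
    have := hall θ hθ
    rw [add_comm r l, pow_add, hrpow] at this
    calc _ ≤ _ := this
      _ = _ := by ring
  have h2 : ‖((1 - T θ) ^ l) (y - u)‖ ≤ 2 ^ l * (K * M * |θ| ^ α / (1 - q)) :=
    (hT.norm_diff_pow_le θ l _).trans (by gcongr)
  have h3 : ((1 - T θ) ^ l) u = ((1 - T θ) ^ l) y - ((1 - T θ) ^ l) (y - u) := by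
    rw [map_sub]; abel
  rw [h3]
  refine (norm_sub_le _ _).trans ?_
  calc _ ≤ P * M * |θ| ^ α + 2 ^ l * (K * M * |θ| ^ α / (1 - q)) := add_le_add h1 h2
    _ = _ := by ring

/-! ### Rotations of the sphere -/

section Rotation

variable {d : ℕ} {i j : Fin d}

theorem rotVec_zero (x : E d) : rotVec i j 0 x = x := by
  ext k
  by_cases hi : k = i
  · simp [rotVec, hi]
  · by_cases hj : k = j
    · subst hj
      simp [rotVec, hi]
    · simp [rotVec, hi, hj]

theorem rotVec_add (h : i ≠ j) (s t : ℝ) (x : E d) :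
    rotVec i j (s + t) x = rotVec i j s (rotVec i j t x) := by
  ext k
  by_cases hi : k = i
  · simp only [rotVec, hi, h.symm, if_true, if_false, Real.cos_add, Real.sin_add]
    ring
  · by_cases hj : k = j
    · simp only [rotVec, hj, h.symm, if_true, if_false, Real.cos_add, Real.sin_add]
      ring
    · simp [rotVec, hi, hj]

/-- The rotation `Q_{i,j,t}` as a linear isometry of `ℝ^d`. -/
def rotEquiv (h : i ≠ j) (t : ℝ) : E d ≃ₗᵢ[ℝ] E d where
  toFun := rotVec i j t
  invFun := rotVec i j (-t)
  left_inv x := by rw [← rotVec_add h, neg_add_cancel, rotVec_zero]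
  right_inv x := by rw [← rotVec_add h, add_neg_cancel, rotVec_zero]
  map_add' x y := by
    ext k
    simp only [rotVec, PiLp.add_apply]
    split_ifs <;> ring
  map_smul' c x := by
    ext k
    simp only [rotVec, PiLp.smul_apply, smul_eq_mul, RingHom.id_apply]
    split_ifs <;> ring
  norm_map' x := norm_rotVec h t x

theorem contDiff_rotVec : ContDiff ℝ (⊤ : ℕ∞) fun q : ℝ × E d => rotVec i j q.1 q.2 := by
  rw [contDiff_euclidean]
  have hk : ∀ k : Fin d, ContDiff ℝ (⊤ : ℕ∞) fun q : ℝ × E d => q.2 k := fun k =>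
    (contDiff_euclidean.1 contDiff_snd) k
  have hc : ContDiff ℝ (⊤ : ℕ∞) fun q : ℝ × E d => Real.cos q.1 :=
    Real.contDiff_cos.comp contDiff_fst
  have hs : ContDiff ℝ (⊤ : ℕ∞) fun q : ℝ × E d => Real.sin q.1 :=
    Real.contDiff_sin.comp contDiff_fst
  intro k
  simp only [rotVec]
  split_ifs
  · exact ((hk i).mul hc).sub ((hk j).mul hs)
  · exact ((hk i).mul hs).add ((hk j).mul hc)
  · exact hk k

theorem rot_zero (h : i ≠ j) (x : S d) : rot h 0 x = x := Subtype.ext (rotVec_zero _)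

theorem rot_add (h : i ≠ j) (s t : ℝ) (x : S d) : rot h (s + t) x = rot h s (rot h t x) :=
  Subtype.ext (rotVec_add h s t _)

theorem rot_neg_rot (h : i ≠ j) (t : ℝ) (x : S d) : rot h (-t) (rot h t x) = x := by
  rw [← rot_add, neg_add_cancel, rot_zero]

theorem rot_rot_neg (h : i ≠ j) (t : ℝ) (x : S d) : rot h t (rot h (-t) x) = x := by
  rw [← rot_add, add_neg_cancel, rot_zero]

theorem continuous_rot_uncurry (h : i ≠ j) : Continuous fun q : ℝ × S d => rot h q.1 q.2 :=
  (contDiff_rotVec.continuous.comp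
    (continuous_fst.prodMk (continuous_subtype_val.comp continuous_snd))).subtype_mk _

theorem continuous_rot (h : i ≠ j) (t : ℝ) : Continuous (rot h t : S d → S d) :=
  (continuous_rot_uncurry h).comp (continuous_const.prodMk continuous_id)

instance : IsFiniteMeasure (σ d) := by unfold σ; infer_instance

instance : (σ d).IsOpenPosMeasure := by unfold σ; infer_instance

-- The measure of `s` is a multiple of the volume of the cone over `s`; a rotation is linear, so it
-- carries cones to cones and preserves their volume.
open Pointwise in
theorem measurePreserving_rot (h : i ≠ j) (t : ℝ) :
    MeasurePreserving (rot h t : S d → S d) (σ d) (σ d) := by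
  refine ⟨(continuous_rot h t).measurable, Measure.ext fun s hs => ?_⟩
  have hpre := (continuous_rot h t).measurable hs
  rw [Measure.map_apply (continuous_rot h t).measurable hs, σ, Measure.toSphere_apply' _ hs,
    Measure.toSphere_apply' _ hpre]
  congr 1
  have e : Set.Ioo (0 : ℝ) 1 • ((↑) '' (rot h t ⁻¹' s) : Set (E d))
      = (rotEquiv h t) ⁻¹' (Set.Ioo (0 : ℝ) 1 • ((↑) '' s : Set (E d))) := by
    ext y
    simp only [Set.mem_preimage, Set.mem_smul, Set.exists_mem_image]
    constructor
    · rintro ⟨c, hc, x, hx, rfl⟩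
      exact ⟨c, hc, rot h t x, hx, ((rotEquiv h t).map_smul c x).symm⟩
    · rintro ⟨c, hc, x, hx, hy⟩
      refine ⟨c, hc, rot h (-t) x, by rwa [rot_rot_neg], ?_⟩
      apply (rotEquiv h t).injective
      rw [← hy, map_smul]
      congr 1
      exact congrArg Subtype.val (rot_rot_neg h t x)
  rw [e]
  exact (rotEquiv h t).measurePreserving.measure_preimage_equiv
    (f := (rotEquiv h t).toHomeomorph.toMeasurableEquiv) _

/-! ### Smooth functions on the sphere -/

theorem IsSmooth.continuous {g : S d → ℝ} (hg : IsSmooth g) : Continuous g := by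
  obtain ⟨G, hG, h⟩ := hg
  rw [funext h]
  exact hG.continuous.comp continuous_subtype_val

theorem IsSmooth.comp_rot {g : S d → ℝ} (hg : IsSmooth g) (h : i ≠ j) (t : ℝ) :
    IsSmooth fun x => g (rot h t x) := by
  obtain ⟨G, hG, hgG⟩ := hg
  exact ⟨fun x => G (rotVec i j t x), hG.comp (rotEquiv h t).contDiff, fun x => hgG _⟩

theorem IsSmooth.hasDerivAt_zero {g : S d → ℝ} (hg : IsSmooth g) (h : i ≠ j) (x : S d) :
    HasDerivAt (fun t : ℝ => g (rot h (-t) x)) (D h g x) 0 := by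
  obtain ⟨G, hG, hgG⟩ := hg
  refine DifferentiableAt.hasDerivAt ?_
  have e : (fun t : ℝ => g (rot h (-t) x)) = fun t => G (rotVec i j (-t) x) :=
    funext fun t => hgG _
  rw [e]
  exact ((hG.comp (contDiff_rotVec.comp (contDiff_neg.prodMk contDiff_const))).differentiable
    (by simp)).differentiableAt

theorem IsSmooth.hasDerivAt {g : S d → ℝ} (hg : IsSmooth g) (h : i ≠ j) (x : S d) (t : ℝ) :
    HasDerivAt (fun t : ℝ => g (rot h (-t) x)) (D h g (rot h (-t) x)) t := by
  have h1 := HasDerivAt.comp_of_eq t (hg.hasDerivAt_zero h (rot h (-t) x))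
    ((hasDerivAt_id t).sub_const t) (sub_self t).symm
  rw [mul_one] at h1
  refine h1.congr_of_eventuallyEq (Eventually.of_forall fun s => ?_)
  simp only [Function.comp_apply, id_eq]
  rw [← rot_add]
  congr 2
  ring

/-- The `t`-derivative at 0 of the rotated extension is defined and smooth on all of `ℝ^d`, hence
extends `D h g`. -/
theorem IsSmooth.deriv {g : S d → ℝ} (hg : IsSmooth g) (h : i ≠ j) : IsSmooth (D h g) := by
  obtain ⟨G, hG, hgG⟩ := hg
  set F : ℝ × E d → ℝ := fun q => G (rotVec i j (-q.1) q.2) with hF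
  have hFc : ContDiff ℝ (⊤ : ℕ∞) F :=
    hG.comp (contDiff_rotVec.comp (contDiff_fst.neg.prodMk contDiff_snd))
  refine ⟨fun x => fderiv ℝ F (0, x) (1, 0), ?_, fun x => ?_⟩
  · exact ((hFc.fderiv_right (m := (⊤ : ℕ∞)) (by simp)).comp
      (contDiff_const.prodMk contDiff_id)).clm_apply contDiff_const
  · have e : (fun t : ℝ => g (rot h (-t) x)) = fun t => F (t, (x : E d)) :=
      funext fun t => hgG _
    have h1 : HasFDerivAt F (fderiv ℝ F (0, (x : E d))) (0, (x : E d)) :=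
      ((hFc.differentiable (by simp)) _).hasFDerivAt
    have h2 : HasDerivAt (fun t : ℝ => (t, (x : E d))) ((1 : ℝ), (0 : E d)) 0 :=
      (hasDerivAt_id _).prodMk (hasDerivAt_const _ _)
    rw [D, e]
    exact (h1.comp_hasDerivAt (0 : ℝ) h2).deriv

theorem D_comp_rot (h : i ≠ j) (t : ℝ) (g : S d → ℝ) :
    D h (fun x => g (rot h t x)) = fun x => D h g (rot h t x) := by
  funext x
  simp only [D, ← rot_add, add_comm t]

theorem D_iterate_comp_rot (h : i ≠ j) (t : ℝ) (k : ℕ) (g : S d → ℝ) :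
    (D h)^[k] (fun x => g (rot h t x)) = fun x => (D h)^[k] g (rot h t x) := by
  induction k with
  | zero => rfl
  | succ k ih => rw [Function.iterate_succ_apply', ih, D_comp_rot, Function.iterate_succ_apply']

/-- The type of smooth functions on the sphere. -/
abbrev Smooth (d : ℕ) : Type := {g : S d → ℝ // IsSmooth g}

/-- The operator `D_{i,j}` on smooth functions. -/
def smoothD (h : i ≠ j) (g : Smooth d) : Smooth d := ⟨D h g.1, g.2.deriv h⟩

theorem coe_smoothD_iterate (h : i ≠ j) (k : ℕ) (g : Smooth d) :
    ((smoothD h)^[k] g).1 = (D h)^[k] g.1 := by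
  induction k with
  | zero => rfl
  | succ k ih =>
    rw [Function.iterate_succ_apply', Function.iterate_succ_apply']
    exact congrArg (D h) ih

theorem IsSmooth.exists_bound {g : S d → ℝ} (hg : IsSmooth g) : ∃ C, ∀ x, ‖g x‖ ≤ C := by
  obtain ⟨C, hC⟩ := isCompact_univ.exists_bound_of_continuousOn hg.continuous.continuousOn
  exact ⟨C, fun x => hC x (Set.mem_univ x)⟩

theorem integral_comp_rot_mul (h : i ≠ j) (t : ℝ) (f g : S d → ℝ) :
    ∫ x, f (rot h t x) * g x ∂(σ d) = ∫ x, f x * g (rot h (-t) x) ∂(σ d) := by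
  have hemb : MeasurableEmbedding (rot h t : S d → S d) :=
    MeasurableEquiv.measurableEmbedding
      { toFun := rot h t, invFun := rot h (-t), left_inv := rot_neg_rot h t,
        right_inv := rot_rot_neg h t, measurable_toFun := (continuous_rot h t).measurable,
        measurable_invFun := (continuous_rot h (-t)).measurable }
  have := (measurePreserving_rot h t).integral_comp hemb fun x => f x * g (rot h (-t) x)
  simpa only [rot_neg_rot] using this

/-- Invariance of the measure moves the rotation onto the smooth factor, so `f` need only be
integrable. -/
theorem hasDerivAt_integral_rot_mul (h : i ≠ j) {f g : S d → ℝ} (hf : Integrable f (σ d))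
    (hg : IsSmooth g) :
    HasDerivAt (fun t => ∫ x, f (rot h t x) * g x ∂(σ d)) (∫ x, f x * D h g x ∂(σ d)) 0 := by
  obtain ⟨C, hC⟩ := (hg.deriv h).exists_bound
  rw [funext fun t => integral_comp_rot_mul h t f g]
  have hmeas : ∀ {k : S d → ℝ}, IsSmooth k → ∀ t,
      AEStronglyMeasurable (fun x => f x * k (rot h t x)) (σ d) := fun hk t =>
    hf.aestronglyMeasurable.mul (hk.comp_rot h t).continuous.aestronglyMeasurable
  have hint : Integrable (fun x => f x * g (rot h (-0) x)) (σ d) := by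
    obtain ⟨B, hB⟩ := (hg.comp_rot h (-0)).exists_bound
    exact hf.mul_bdd (hg.comp_rot h (-0)).continuous.aestronglyMeasurable
      (Eventually.of_forall hB)
  have := (hasDerivAt_integral_of_dominated_loc_of_deriv_le
    (F := fun t x => f x * g (rot h (-t) x)) (F' := fun t x => f x * D h g (rot h (-t) x))
    (bound := fun x => ‖f x‖ * C) (x₀ := 0) (μ := σ d) univ_mem
    (Eventually.of_forall fun t => hmeas hg (-t)) hint (hmeas (hg.deriv h) (-0))
    (Eventually.of_forall fun x t _ => by
      rw [norm_mul]
      exact mul_le_mul_of_nonneg_left (hC _) (norm_nonneg _))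
    (hf.norm.mul_const C)
    (Eventually.of_forall fun x t _ => (hg.hasDerivAt h x t).const_mul (f x))).2
  simpa only [neg_zero, rot_zero] using this

/-- Reduces to `ℝ^d` with the pushforward of `σ d`: restrictions of smooth compactly supported
functions are admissible tests. -/
theorem ae_eq_zero_of_integral_mul_smooth {f : S d → ℝ} (hf : Integrable f (σ d))
    (h : ∀ g, IsSmooth g → ∫ x, f x * g x ∂(σ d) = 0) : f =ᵐ[σ d] 0 := by
  have hemb : MeasurableEmbedding ((↑) : S d → E d) :=
    MeasurableEmbedding.subtype_coe Metric.isClosed_sphere.measurableSet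
  set F : E d → ℝ := Function.extend (↑) f 0 with hF
  have hFf : ∀ x : S d, F x = f x := fun x => Subtype.val_injective.extend_apply f 0 x
  have hint : Integrable F ((σ d).map (↑)) := by
    rw [hemb.integrable_map_iff]
    exact hf.congr (Eventually.of_forall fun x => (hFf x).symm)
  have hz := ae_eq_zero_of_integral_contDiff_smul_eq_zero hint.locallyIntegrable
    fun g hg _ => by
      rw [hemb.integral_map]
      rw [← h (fun x => g x) ⟨g, hg, fun _ => rfl⟩]
      refine integral_congr_ae (Eventually.of_forall fun x => ?_)
      simp only [hFf, smul_eq_mul, mul_comm]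
  rw [hemb.ae_map_iff] at hz
  filter_upwards [hz] with x hx
  rw [← hFf x, hx, Pi.zero_apply]

end Rotation

/-! ### The spaces `L^p` and `C` as models -/

section Model

variable {d : ℕ} {i j : Fin d} {p : ℝ≥0∞}

theorem memX_top {f : S d → ℝ} : MemX ∞ f ↔ Continuous f := by simp [MemX]

theorem memX_of_ne_top (hp : p ≠ ∞) {f : S d → ℝ} : MemX p f ↔ MemLp f p (σ d) := by
  simp [MemX, hp]

theorem MemX.memLp {f : S d → ℝ} (hf : MemX p f) : MemLp f p (σ d) := by
  by_cases hp : p = ∞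
  · subst hp
    exact (memX_top.1 hf).memLp_top_of_hasCompactSupport (HasCompactSupport.of_compactSpace f) _
  · exact (memX_of_ne_top hp).1 hf

theorem MemX.integrable {f : S d → ℝ} (hf : MemX p f) (hp : 1 ≤ p) : Integrable f (σ d) :=
  hf.memLp.integrable hp

theorem MemX.comp_rot {f : S d → ℝ} (hf : MemX p f) (h : i ≠ j) (t : ℝ) :
    MemX p fun x => f (rot h t x) := by
  by_cases hp : p = ∞
  · subst hp
    exact memX_top.2 ((memX_top.1 hf).comp (continuous_rot h t))
  · exact (memX_of_ne_top hp).2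
      (((memX_of_ne_top hp).1 hf).comp_measurePreserving (measurePreserving_rot h t))

theorem MemX.sub {f g : S d → ℝ} (hf : MemX p f) (hg : MemX p g) :
    MemX p fun x => f x - g x := by
  by_cases hp : p = ∞
  · subst hp
    exact memX_top.2 ((memX_top.1 hf).sub (memX_top.1 hg))
  · exact (memX_of_ne_top hp).2 (((memX_of_ne_top hp).1 hf).sub ((memX_of_ne_top hp).1 hg))

theorem MemX.diffPow {f : S d → ℝ} (hf : MemX p f) (h : i ≠ j) (θ : ℝ) (m : ℕ) :
    MemX p (diffPow h θ m f) := by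
  induction m with
  | zero => exact hf
  | succ m ih =>
    rw [SphereLip.diffPow, Function.iterate_succ_apply']
    exact ih.sub (ih.comp_rot h θ)

/-- The Banach space `X`, with the group `T` and the functionals `L`, represents the function space
`MemX p` with its rotations in the `(x_i, x_j)`-plane and its pairing with smooth functions. -/
structure IsModel (h : i ≠ j) (p : ℝ≥0∞) {X : Type} [NormedAddCommGroup X] [NormedSpace ℝ X]
    (T : ℝ → X →L[ℝ] X) (L : Smooth d → X →L[ℝ] ℝ) (toX : ∀ f : S d → ℝ, MemX p f → X) :
    Prop where
  exists_rep : ∀ x, ∃ f hf, toX f hf = x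
  enorm_toX : ∀ f hf, ‖toX f hf‖ₑ = normX p f
  T_toX : ∀ t f hf, T t (toX f hf) = toX (fun x => f (rot h t x)) (hf.comp_rot h t)
  sub_toX : ∀ f g hf hg, toX f hf - toX g hg = toX (fun x => f x - g x) (hf.sub hg)
  L_toX : ∀ g f hf, L g (toX f hf) = ∫ x, f x * g.1 x ∂(σ d)
  norm_T : ∀ t x, ‖T t x‖ ≤ ‖x‖
  cont : ∀ x, Continuous fun t => T t x
  separating : ∀ x, (∀ g, L g x = 0) → x = 0

theorem enorm_continuousMap {α : Type*} [TopologicalSpace α] [CompactSpace α] (f : C(α, ℝ)) :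
    ‖f‖ₑ = ⨆ x, ‖f x‖ₑ := by
  refine le_antisymm ?_ (iSup_le fun x => enorm_le_iff_norm_le.2 (f.norm_coe_le_norm x))
  refine ENNReal.le_of_forall_nnreal_lt fun c hc => ?_
  by_contra! hlt
  refine absurd hc (not_lt.2 ?_)
  rw [enorm_le_coe, ← NNReal.coe_le_coe, coe_nnnorm]
  refine (f.norm_le c.2).2 fun x => ?_
  have := (le_iSup (fun x => ‖f x‖ₑ) x).trans hlt.le
  rwa [enorm_le_coe, ← NNReal.coe_le_coe, coe_nnnorm] at this

/-- Strong continuity comes from currying the jointly continuous action. Since `σ d` charges open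
sets, a continuous function that vanishes almost everywhere is zero, hence test functions separate
points. -/
theorem exists_model_top (h : i ≠ j) :
    ∃ (X : Type) (_ : NormedAddCommGroup X) (_ : NormedSpace ℝ X) (_ : CompleteSpace X)
      (T : ℝ → X →L[ℝ] X) (L : Smooth d → X →L[ℝ] ℝ) (toX : ∀ f : S d → ℝ, MemX ∞ f → X),
      IsModel h ∞ T L toX := by
  have hg : ∀ g : Smooth d, MemLp g.1 ∞ (σ d) := fun g =>
    MemX.memLp (memX_top.2 g.2.continuous)
  have hL : ∀ (g : Smooth d) (f : C(S d, ℝ)),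
      ((ContinuousLinearMap.mul ℝ ℝ).lpPairing (σ d) 1 ∞).flip ((hg g).toLp _)
        (ContinuousMap.toLp 1 (σ d) ℝ f) = ∫ x, f x * g.1 x ∂(σ d) := by
    intro g f
    rw [ContinuousLinearMap.flip_apply, ContinuousLinearMap.lpPairing_eq_integral]
    refine integral_congr_ae ?_
    filter_upwards [ContinuousMap.coeFn_toLp (p := 1) (σ d) (𝕜 := ℝ) f, (hg g).coeFn_toLp]
      with x h1 h2
    rw [h1, h2, ContinuousLinearMap.mul_apply']
  let A : ℝ → C(S d, ℝ) →ₗ[ℝ] C(S d, ℝ) := fun t =>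
    { toFun := fun f => f.comp ⟨rot h t, continuous_rot h t⟩
      map_add' := fun _ _ => rfl
      map_smul' := fun _ _ => rfl }
  have hA : ∀ t f, ‖A t f‖ ≤ ‖f‖ := fun t f =>
    (ContinuousMap.norm_le _ (norm_nonneg f)).2 fun x => f.norm_coe_le_norm _
  let T : ℝ → C(S d, ℝ) →L[ℝ] C(S d, ℝ) := fun t =>
    (A t).mkContinuous 1 fun f => by rw [one_mul]; exact hA t f
  have hT : ∀ t f, ‖T t f‖ ≤ ‖f‖ := hA
  refine ⟨C(S d, ℝ), inferInstance, inferInstance, inferInstance, T,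
    fun g => (((ContinuousLinearMap.mul ℝ ℝ).lpPairing (σ d) 1 ∞).flip ((hg g).toLp _)).comp
      (ContinuousMap.toLp 1 (σ d) ℝ), fun f hf => ⟨f, memX_top.1 hf⟩,
    fun x => ⟨x, memX_top.2 x.continuous, rfl⟩, fun f hf => ?_, fun t f hf => rfl,
    fun f g hf hg => rfl, fun g f hf => hL g _, hT, fun x => ?_, fun x hx => ?_⟩
  · rw [enorm_continuousMap, normX, if_pos rfl]
    rfl
  · exact (ContinuousMap.curry ⟨fun q : ℝ × S d => x (rot h q.1 q.2),
      x.continuous.comp (continuous_rot_uncurry h)⟩).continuous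
  · have hae := ae_eq_zero_of_integral_mul_smooth
      ((memX_top.2 x.continuous).integrable le_top) fun g hgs => (hL ⟨g, hgs⟩ x).symm.trans (hx _)
    exact ContinuousMap.ext fun y => congrFun
      (Continuous.ae_eq_iff_eq (σ d) x.continuous continuous_zero |>.1 hae) y

/-- Finiteness of `p` is what makes the rotations strongly continuous; the functionals are Hölder
pairings. -/
theorem exists_model_of_ne_top (h : i ≠ j) (hp1 : 1 ≤ p) (hp : p ≠ ∞) :
    ∃ (X : Type) (_ : NormedAddCommGroup X) (_ : NormedSpace ℝ X) (_ : CompleteSpace X)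
      (T : ℝ → X →L[ℝ] X) (L : Smooth d → X →L[ℝ] ℝ) (toX : ∀ f : S d → ℝ, MemX p f → X),
      IsModel h p T L toX := by
  have : Fact (1 ≤ p) := ⟨hp1⟩
  have hg : ∀ (g : Smooth d) q, MemLp g.1 q (σ d) := fun g q =>
    (MemX.memLp (memX_top.2 g.2.continuous)).mono_exponent le_top
  have : p.HolderConjugate p.conjExponent := inferInstance
  have : Fact (1 ≤ p.conjExponent) := ⟨ENNReal.HolderConjugate.one_le _ p⟩
  have hL : ∀ (g : Smooth d) (f : S d → ℝ) (hf : MemLp f p (σ d)),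
      ((ContinuousLinearMap.mul ℝ ℝ).lpPairing (σ d) p p.conjExponent).flip ((hg g _).toLp _)
        (hf.toLp f) = ∫ x, f x * g.1 x ∂(σ d) := by
    intro g f hf
    rw [ContinuousLinearMap.flip_apply, ContinuousLinearMap.lpPairing_eq_integral]
    refine integral_congr_ae ?_
    filter_upwards [hf.coeFn_toLp, (hg g p.conjExponent).coeFn_toLp] with x h1 h2
    rw [h1, h2, ContinuousLinearMap.mul_apply']
  refine ⟨Lp ℝ p (σ d), inferInstance, inferInstance, inferInstance,
    fun t => (Lp.compMeasurePreservingₗᵢ ℝ (rot h t)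
      (measurePreserving_rot h t)).toContinuousLinearMap,
    fun g => ((ContinuousLinearMap.mul ℝ ℝ).lpPairing (σ d) p p.conjExponent).flip
      ((hg g _).toLp _),
    fun f hf => MemLp.toLp f ((memX_of_ne_top hp).1 hf), ?_⟩
  refine ⟨fun x => ⟨x, (memX_of_ne_top hp).2 (Lp.memLp x), Lp.toLp_coeFn _ _⟩, fun f hf => ?_,
    fun t f hf => rfl, fun f g hf hg => rfl, fun g f hf => hL g f _, fun t x => ?_,
    fun x => ?_, fun x hx => ?_⟩
  · rw [normX, if_neg hp, Lp.enorm_toLp]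
  · exact (LinearIsometry.norm_map _ x).le
  · exact (continuous_const (y := x)).compMeasurePreservingLp
      (g := fun t => (⟨rot h t, continuous_rot h t⟩ : C(S d, S d)))
      (ContinuousMap.curry ⟨_, continuous_rot_uncurry h⟩).continuous
      (measurePreserving_rot h) hp
  · have hm := Lp.memLp x
    rw [Lp.eq_zero_iff_ae_eq_zero]
    refine ae_eq_zero_of_integral_mul_smooth (hm.integrable hp1) fun g hgs => ?_
    rw [← hL ⟨g, hgs⟩ x hm, Lp.toLp_coeFn]
    exact hx _

theorem exists_model (h : i ≠ j) (hp : 1 ≤ p) :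
    ∃ (X : Type) (_ : NormedAddCommGroup X) (_ : NormedSpace ℝ X) (_ : CompleteSpace X)
      (T : ℝ → X →L[ℝ] X) (L : Smooth d → X →L[ℝ] ℝ) (toX : ∀ f : S d → ℝ, MemX p f → X),
      IsModel h p T L toX := by
  by_cases hpt : p = ∞
  · subst hpt
    exact exists_model_top h
  · exact exists_model_of_ne_top h hp hpt

/-! ### Transfer of the abstract estimates to functions on the sphere -/

namespace IsModel

variable {h : i ≠ j} {X : Type} [NormedAddCommGroup X] [NormedSpace ℝ X]
  {T : ℝ → X →L[ℝ] X} {L : Smooth d → X →L[ℝ] ℝ} {toX : ∀ f : S d → ℝ, MemX p f → X}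

theorem isTestedGroup (hm : IsModel h p T L toX) (hp : 1 ≤ p) :
    IsTestedGroup T L (smoothD h) where
  zero := by
    ext x
    obtain ⟨f, hf, rfl⟩ := hm.exists_rep x
    rw [hm.T_toX]
    simp only [rot_zero]
    rfl
  add s t := by
    ext x
    obtain ⟨f, hf, rfl⟩ := hm.exists_rep x
    change _ = T s (T t (toX f hf))
    simp only [hm.T_toX, ← rot_add, add_comm s t]
  norm_le := hm.norm_T
  cont := hm.cont
  hasDerivAt g x := by
    obtain ⟨f, hf, rfl⟩ := hm.exists_rep x
    simp only [hm.T_toX, hm.L_toX]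
    exact hasDerivAt_integral_rot_mul h (hf.integrable hp) g.2
  translate t g := by
    refine ⟨⟨_, g.2.comp_rot h (-t)⟩, fun k x => ?_⟩
    obtain ⟨f, hf, rfl⟩ := hm.exists_rep x
    rw [hm.T_toX, hm.L_toX, hm.L_toX, coe_smoothD_iterate, coe_smoothD_iterate,
      integral_comp_rot_mul, D_iterate_comp_rot]
  separating := hm.separating

theorem toX_diffPow (hm : IsModel h p T L toX) (θ : ℝ) (m : ℕ) {f : S d → ℝ} (hf : MemX p f) :
    ((1 - T θ) ^ m) (toX f hf) = toX (diffPow h θ m f) (hf.diffPow h θ m) := by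
  induction m with
  | zero => rfl
  | succ m ih =>
    rw [pow_succ']
    change ((1 - T θ) ^ m) (toX f hf) - T θ (((1 - T θ) ^ m) (toX f hf)) = _
    rw [ih, hm.T_toX, hm.sub_toX]
    simp only [diffPow, Function.iterate_succ_apply']
    rfl

theorem enorm_diffPow (hm : IsModel h p T L toX) (θ : ℝ) (m : ℕ) {f : S d → ℝ} (hf : MemX p f) :
    ‖((1 - T θ) ^ m) (toX f hf)‖ₑ = normX p (diffPow h θ m f) := by
  rw [hm.toX_diffPow, hm.enorm_toX]

theorem isWeakDeriv_iff (hm : IsModel h p T L toX) (r : ℕ) {f u : S d → ℝ} (hf : MemX p f)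
    (hu : MemX p u) :
    IsWeakDeriv L (smoothD h) r (toX f hf) (toX u hu) ↔ IsWeakD h r f u := by
  simp only [IsWeakDeriv, hm.L_toX, coe_smoothD_iterate, Subtype.forall, IsWeakD]

end IsModel

theorem normX_diffPow_add_le (h : i ≠ j) (hp : 1 ≤ p) {r : ℕ} {f u : S d → ℝ} (hf : MemX p f)
    (hu : MemX p u) (hfu : IsWeakD h r f u) (θ : ℝ) (l : ℕ) :
    normX p (diffPow h θ (r + l) f)
      ≤ ENNReal.ofReal (|θ| ^ r) * normX p (diffPow h θ l u) := by
  obtain ⟨X, _, _, _, T, L, toX, hm⟩ := exists_model h hp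
  rw [← hm.enorm_diffPow θ _ hf, ← hm.enorm_diffPow θ _ hu, ← ofReal_norm, ← ofReal_norm,
    ← ENNReal.ofReal_mul (by positivity)]
  exact ENNReal.ofReal_le_ofReal
    ((hm.isTestedGroup hp).norm_diff_pow_add_le ((hm.isWeakDeriv_iff r hf hu).2 hfu) θ l)

/-- Makes the arbitrary choice of representative in `weakD` harmless. -/
theorem normX_diffPow_congr (h : i ≠ j) (hp : 1 ≤ p) {r : ℕ} {f u v : S d → ℝ} (hf : MemX p f)
    (hu : MemX p u) (hv : MemX p v) (hfu : IsWeakD h r f u) (hfv : IsWeakD h r f v) (θ : ℝ)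
    (l : ℕ) : normX p (diffPow h θ l u) = normX p (diffPow h θ l v) := by
  obtain ⟨X, _, _, _, T, L, toX, hm⟩ := exists_model h hp
  rw [← hm.enorm_diffPow θ _ hu, ← hm.enorm_diffPow θ _ hv,
    (hm.isTestedGroup hp).weakDeriv_unique ((hm.isWeakDeriv_iff r hf hu).2 hfu)
      ((hm.isWeakDeriv_iff r hf hv).2 hfv)]

/-- The inverse estimate on the sphere. -/
theorem exists_isWeakD_of_normX_diffPow_le (r l : ℕ) (hr : 1 ≤ r) (hl : 1 ≤ l) (α : ℝ)
    (hα0 : 0 < α) (hα1 : α < 1) : ∃ C : NNReal, ∀ {d : ℕ} {i j : Fin d} (h : i ≠ j) {p : ℝ≥0∞},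
      1 ≤ p → ∀ {f : S d → ℝ}, MemX p f → ∀ M : NNReal, normX p f ≤ M →
      (∀ θ, 0 < |θ| → |θ| ≤ 1 →
        normX p (diffPow h θ (r + l) f) ≤ M * ENNReal.ofReal (|θ| ^ ((r : ℝ) + α))) →
      ∃ u, MemX p u ∧ IsWeakD h r f u ∧
        ∀ θ, θ ≠ 0 → normX p (diffPow h θ l u) ≤ C * M * ENNReal.ofReal (|θ| ^ α) := by
  obtain ⟨C, hC, hmain⟩ := exists_weakDeriv_of_diff_pow_le r l hr hl α hα0 hα1
  lift C to NNReal using hC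
  refine ⟨C, fun {d i j} h {p} hp {f} hf M hfM hdiff => ?_⟩
  obtain ⟨X, _, _, _, T, L, toX, hm⟩ := exists_model h hp
  have key : ∀ (x : X) (c : NNReal) (b : ℝ), 0 ≤ b →
      (‖x‖ₑ ≤ c * ENNReal.ofReal b ↔ ‖x‖ ≤ c * b) := fun x c b hb => by
    rw [← ofReal_norm, ← ENNReal.ofReal_coe_nnreal, ← ENNReal.ofReal_mul c.coe_nonneg,
      ENNReal.ofReal_le_ofReal_iff (mul_nonneg c.coe_nonneg hb)]
  obtain ⟨u, hu, hbound⟩ := hmain (hm.isTestedGroup hp) (toX f hf) M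
    (by simpa [hm.enorm_toX, hfM] using key (toX f hf) M 1 zero_le_one)
    (fun θ h0 h1 => (key _ M _ (by positivity)).1 (by
      rw [hm.enorm_diffPow]
      exact hdiff θ h0 h1))
  obtain ⟨u, hu', rfl⟩ := hm.exists_rep u
  refine ⟨u, hu', (hm.isWeakDeriv_iff r hf hu').1 hu, fun θ hθ => ?_⟩
  have := (key _ (C * M) _ (by positivity)).2 (hbound θ hθ)
  rwa [hm.enorm_diffPow, ENNReal.coe_mul] at this

end Model

/-! ### Comparison of the norms -/

section Norms

variable {d : ℕ} {p : ℝ≥0∞} {r l : ℕ} {α : ℝ} {f : S d → ℝ}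

theorem weakD_spec {i j : Fin d} {h : i ≠ j} (H : HasWeakD h p r f) :
    MemX p (weakD h p r f) ∧ IsWeakD h r f (weakD h p r f) := by
  rw [weakD, dif_pos H]
  exact H.choose_spec

theorem hNorm_le_lipNorm (hr : 1 ≤ r) (hp : 1 ≤ p) (hα0 : 0 ≤ α) (hf : f ∈ sobolev d p r) :
    hNorm p r l α f ≤ lipNorm p r l α f := by
  rw [hNorm, lipNorm]
  set B := ⨆ (i : Fin d) (j : Fin d) (h : i < j) (θ : ℝ) (_ : 0 < |θ| ∧ |θ| ≤ 1),
    normX p (diffPow h.ne θ l (weakD h.ne p r f)) / ENNReal.ofReal (|θ| ^ α) with hB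
  gcongr
  refine iSup₂_le fun t ht => ENNReal.div_le_of_le_mul ?_
  refine iSup₂_le fun θ hθ => iSup₂_le fun i j => iSup_le fun h => ?_
  obtain ⟨hu, hfu⟩ := weakD_spec (hf.2 i j h)
  refine (normX_diffPow_add_le h.ne hp hf.1 hu hfu θ l).trans ?_
  -- The modulus admits `θ = 0`, which the supremum in `lipNorm` excludes; there the factor `|θ| ^
  -- r` vanishes since `1 ≤ r`.
  rcases eq_or_ne θ 0 with rfl | hθ0
  · simp [show r ≠ 0 by omega]
  · have hpos : 0 < |θ| := abs_pos.2 hθ0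
    have h1 : normX p (diffPow h.ne θ l (weakD h.ne p r f)) / ENNReal.ofReal (|θ| ^ α) ≤ B :=
      le_iSup_of_le i <| le_iSup_of_le j <| le_iSup_of_le h <|
        le_iSup₂_of_le θ ⟨hpos, hθ.trans ht.2⟩ le_rfl
    rw [ENNReal.div_le_iff (by simp; positivity) ENNReal.ofReal_ne_top] at h1
    calc _ ≤ ENNReal.ofReal (|θ| ^ r) * (B * ENNReal.ofReal (|θ| ^ α)) := by gcongr
      _ = B * ENNReal.ofReal (|θ| ^ ((r : ℝ) + α)) := by
        rw [Real.rpow_add hpos, Real.rpow_natCast, ENNReal.ofReal_mul (by positivity)]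
        ring
      _ ≤ _ := by gcongr

theorem normX_diffPow_le_hNorm {i j : Fin d} (h : i < j) {θ : ℝ} (h0 : 0 < |θ|) (h1 : |θ| ≤ 1) :
    normX p (diffPow h.ne θ (r + l) f)
      ≤ hNorm p r l α f * ENNReal.ofReal (|θ| ^ ((r : ℝ) + α)) := by
  rw [← ENNReal.div_le_iff (by simp; positivity) ENNReal.ofReal_ne_top]
  refine le_add_of_nonneg_of_le zero_le (le_iSup₂_of_le |θ| ⟨h0, h1⟩ ?_)
  gcongr
  exact le_iSup₂_of_le θ le_rfl <| le_iSup₂_of_le i j <| le_iSup_of_le h le_rfl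

/-- The H-norm itself serves as `M` in the inverse estimate, bounding both `f` and its differences;
the derivative found there is then exchanged for `weakD`. -/
theorem exists_lipNorm_le_hNorm (hr : 1 ≤ r) (hl : 1 ≤ l) (hα0 : 0 < α) (hα1 : α < 1) :
    ∃ c : NNReal, ∀ {d : ℕ} {p : ℝ≥0∞} {f : S d → ℝ}, 1 ≤ p → f ∈ hSpace d p r l α →
      f ∈ sobolev d p r ∧ lipNorm p r l α f ≤ c * hNorm p r l α f := by
  obtain ⟨C, hC⟩ := exists_isWeakD_of_normX_diffPow_le r l hr hl α hα0 hα1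
  refine ⟨1 + C, fun {d p f} hp hf => ?_⟩
  obtain ⟨M, hM⟩ : ∃ M : NNReal, (M : ℝ≥0∞) = hNorm p r l α f :=
    ⟨_, ENNReal.coe_toNNReal hf.2.ne⟩
  have hfM : normX p f ≤ M := hM ▸ le_self_add
  have hex : ∀ (i j : Fin d) (h : i < j), ∃ u, MemX p u ∧ IsWeakD h.ne r f u ∧
      ∀ θ, θ ≠ 0 → normX p (diffPow h.ne θ l u) ≤ C * M * ENNReal.ofReal (|θ| ^ α) :=
    fun i j h => hC h.ne hp hf.1 M hfM fun θ h0 h1 => hM ▸ normX_diffPow_le_hNorm h h0 h1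
  have hsob : f ∈ sobolev d p r := ⟨hf.1, fun i j h => by
    obtain ⟨u, hu, hfu, -⟩ := hex i j h
    exact ⟨u, hu, hfu⟩⟩
  refine ⟨hsob, ?_⟩
  rw [← hM, lipNorm, ENNReal.coe_add, add_mul, ENNReal.coe_one, one_mul]
  gcongr
  refine iSup_le fun i => iSup_le fun j => iSup_le fun h => iSup₂_le fun θ hθ =>
    ENNReal.div_le_of_le_mul ?_
  obtain ⟨u, hu, hfu, hbound⟩ := hex i j h
  obtain ⟨hv, hfv⟩ := weakD_spec (hsob.2 i j h)
  rw [normX_diffPow_congr h.ne hp hf.1 hv hu hfv hfu]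
  exact hbound θ (abs_pos.1 hθ.1)

end Norms

end SphereLip

end

theorem theorem3 (d : ℕ) (hd : 2 ≤ d) (r l : ℕ) (hr : 1 ≤ r) (hl : 1 ≤ l)
    (p : ENNReal) (hp : 1 ≤ p) (α : ℝ) (hα0 : 0 ≤ α) (hα1 : α < 1) :
    SphereLip.lipSpace d p r l α ⊆ SphereLip.hSpace d p r l α ∧
    (0 < α → SphereLip.lipSpace d p r l α = SphereLip.hSpace d p r l α) ∧
    ∃ c : NNReal, 0 < c ∧
      (∀ f ∈ SphereLip.lipSpace d p r l α,
        SphereLip.hNorm p r l α f ≤ c * SphereLip.lipNorm p r l α f) ∧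
      (0 < α → ∀ f ∈ SphereLip.lipSpace d p r l α,
        SphereLip.lipNorm p r l α f ≤ c * SphereLip.hNorm p r l α f) := by
  have hsub : SphereLip.lipSpace d p r l α ⊆ SphereLip.hSpace d p r l α := fun f hf =>
    ⟨hf.1.1, (SphereLip.hNorm_le_lipNorm hr hp hα0 hf.1).trans_lt hf.2⟩
  refine ⟨hsub, fun hα => hsub.antisymm fun f hf => ?_, ?_⟩
  · obtain ⟨c, hc⟩ := SphereLip.exists_lipNorm_le_hNorm hr hl hα hα1
    obtain ⟨hsob, hle⟩ := hc hp hf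
    exact ⟨hsob, hle.trans_lt (ENNReal.mul_lt_top ENNReal.coe_lt_top hf.2)⟩
  · have hex : ∃ c : NNReal, 0 < α → ∀ f ∈ SphereLip.lipSpace d p r l α,
        SphereLip.lipNorm p r l α f ≤ c * SphereLip.hNorm p r l α f := by
      by_cases hα : 0 < α
      · obtain ⟨c, hc⟩ := SphereLip.exists_lipNorm_le_hNorm hr hl hα hα1
        exact ⟨c, fun _ f hf => (hc hp (hsub hf)).2⟩
      · exact ⟨0, fun h => absurd h hα⟩
    obtain ⟨c, hc⟩ := hex
    -- The direct inequality holds with constant 1, so `1 + c` serves both directions and is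
    -- positive.
    refine ⟨1 + c, by positivity, fun f hf => ?_, fun hα f hf => (hc hα f hf).trans ?_⟩
    · refine (SphereLip.hNorm_le_lipNorm hr hp hα0 hf.1).trans (le_mul_of_one_le_left' ?_)
      exact_mod_cast le_self_add
    · gcongr
      exact le_add_self
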